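/- Let $N\ge 1$ be an integer and let $a,b>0$ be real numbers. For a function $f$ on $[0,1]^N$ put \[ \langle f(x_1,\dots,x_N)\rangle_{a,b}=\frac1{N!}\int_{[0,1]^N} f(x_1,\dots,x_N)\prod_{1\le i<j\le N}(x_i-x_j)^2\prod_{i=1}^N x_i^{a-1}(1-x_i)^{b-1}\,dx_1\cdots dx_N , \] and for an integer $k>0$ let $p_k(x_1,\dots,x_N)=\sum_{i=1}^N x_i^k$. Then the integrals defining $\langle 1\rangle_{a,b}$ and $\langle p_k\rangle_{a,b}$ converge absolutely, $\langle 1\rangle_{a,b}>0$, and the quotient \[ I_k:=\frac{\langle p_k(x_1,\dots,x_N)\rangle_{a,b}}{\langle 1\rangle_{a,b}} \] satisfies \[ I_k=\frac1{k!}\sum_{i=0}^{k-1}(-1)^i\binom{k-1}{i}\prod_{j=-i}^{k-i-1}\frac{(N+j)(a+N+j-1)}{a+b+2N+j-2}. \] Here the summands with $i\ge N$, whose product contains the factor $N+j=0$ (at $j=-N$), are read as $0$ even if one of their denominators vanishes; for $i<N$ all denominators are positive. -/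

import Mathlib

open MeasureTheory

noncomputable section

/-- The (unnormalised) Jacobi weight
`∏_{i<j} (x_i - x_j)^2 ∏_i x_i^(a-1) (1 - x_i)^(b-1)`. -/
def jacobiWeight (N : ℕ) (a b : ℝ) (x : Fin N → ℝ) : ℝ :=
  (∏ i : Fin N, ∏ j ∈ Finset.Ioi i, (x i - x j) ^ 2) *
    ∏ i : Fin N, x i ^ (a - 1) * (1 - x i) ^ (b - 1)

/-- The bracket `⟨f⟩_{a,b}`: `1/N!` times the integral of `f` against the Jacobi weight over the
cube `[0,1]^N` (here `Set.Icc 0 1` for the coordinatewise order on `Fin N → ℝ`). -/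
def jacobiBracket (N : ℕ) (a b : ℝ) (f : (Fin N → ℝ) → ℝ) : ℝ :=
  1 / (N.factorial : ℝ) *
    ∫ x in Set.Icc (0 : Fin N → ℝ) 1, f x * jacobiWeight N a b x

/-- The power sum `p_k(x_1, …, x_N)`. -/
def powerSum (N k : ℕ) (x : Fin N → ℝ) : ℝ :=
  ∑ i : Fin N, x i ^ k

/-- `I_k = ⟨p_k⟩_{a,b} / ⟨1⟩_{a,b}`. -/
def jacobiMoment (N : ℕ) (a b : ℝ) (k : ℕ) : ℝ :=
  jacobiBracket N a b (powerSum N k) / jacobiBracket N a b (fun _ => 1)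

end

/-! Write the weight as `det (x_j ^ i) * det (x_j ^ i * w (x_j))`, where `w` is its one-variable
factor. Andréief's identity turns `⟨1⟩` into the determinant of the Hankel matrix of moments
`B (a + i + j, b)`. Multiplying a determinant by the power sum `p_k` amounts to multiplying one row
at a time by `x ^ k` and adding up, so `⟨p_k⟩` is the sum over `r` of the same Hankel determinant
with row `r` replaced by row `r + k` of the infinite Hankel matrix.

The first `N` entries of row `y` of that matrix are `B (a + y, b + N - 1) * P_j y`, with polynomials
`P_j` of degree less than `N` that do not depend on `y`. Lagrange interpolation at `0, …, N - 1`
therefore expresses row `r + k` through the first `N` rows, and only the coefficient of row `r`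
survives in the determinant. It is a quotient of beta functions times the value at `r + k` of a
Lagrange basis polynomial; with `i = N - 1 - r` these are the summands of the formula.
-/

open Equiv Matrix Polynomial ProbabilityTheory

section Determinant

variable {n E R : Type*} [Fintype n] [DecidableEq n] [CommRing R]

theorem det_mul_det_eq_sum_sign_mul_det (A B : Matrix n n R) :
    A.det * B.det = ∑ σ : Perm n, (Perm.sign σ : R) * (of fun i j => A (σ i) i * B j i).det := by
  rw [det_apply' A, Finset.sum_mul]
  refine Finset.sum_congr rfl fun σ _ => ?_
  rw [mul_assoc, ← B.det_transpose, ← det_mul_column]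
  rfl

theorem sum_det_updateRow_mul (A B : Matrix n n R) :
    ∑ r, (A.updateRow r ((A * B).row r)).det = B.trace * A.det := by
  have h (r : n) : (A.updateRow r ((A * B).row r)).det = (A * B * A.adjugate) r r := by
    rw [← cramer_transpose_apply, cramer_eq_adjugate_mulVec, ← adjugate_transpose, mulVec_transpose,
      row_def, ← mul_apply_eq_vecMul]
  calc ∑ r, (A.updateRow r ((A * B).row r)).det
      = (A * B * A.adjugate).trace := Finset.sum_congr rfl fun r _ => h r
    _ = B.trace * A.det := by
      rw [trace_mul_cycle, adjugate_mul, smul_mul, one_mul, trace_smul, smul_eq_mul, mul_comm]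

theorem sum_mul_det_eq_sum_det_updateRow (A : Matrix n n R) (d : n → R) :
    (∑ j, d j) * A.det = ∑ r, (A.updateRow r fun j => d j * A r j).det := by
  rw [← trace_diagonal, ← sum_det_updateRow_mul]
  refine Finset.sum_congr rfl fun r _ => ?_
  congr 2
  ext j
  rw [row_apply, mul_diagonal, mul_comm]

/-- The alternant `(f i (x j))`, with one row per function and one column per variable; the
functions `y ↦ y ^ i` give the transposed Vandermonde matrix. -/
def alternantMatrix {ι E α : Type*} (f : ι → E → α) (x : ι → E) : Matrix ι ι α :=
  of fun i j => f i (x j)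

theorem det_alternantMatrix_mul_det_alternantMatrix (f g : n → E → R) (x : n → E) :
    (alternantMatrix f x).det * (alternantMatrix g x).det =
      ∑ σ : Perm n, (Perm.sign σ : R) * (of fun i j => f (σ i) (x i) * g j (x i)).det :=
  det_mul_det_eq_sum_sign_mul_det _ _

theorem sum_mul_det_alternantMatrix (φ : E → R) (f : n → E → R) (x : n → E) :
    (∑ i, φ (x i)) * (alternantMatrix f x).det =
      ∑ r, (alternantMatrix (Function.update f r (φ * f r)) x).det := by
  rw [sum_mul_det_eq_sum_det_updateRow]
  refine Finset.sum_congr rfl fun r _ => congrArg det ?_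
  ext i j
  by_cases hi : i = r
  · subst hi
    simp [alternantMatrix]
  · simp [alternantMatrix, hi]

theorem sum_mul_det_mul_det_alternantMatrix (φ : E → R) (f g : n → E → R) (x : n → E) :
    (∑ i, φ (x i)) * ((alternantMatrix f x).det * (alternantMatrix g x).det) =
      ∑ r, (alternantMatrix (Function.update f r (φ * f r)) x).det * (alternantMatrix g x).det := by
  rw [← mul_assoc, sum_mul_det_alternantMatrix, Finset.sum_mul]

end Determinant

section Pairing

variable {ι E 𝕜 : Type*} [RCLike 𝕜] [MeasurableSpace E]

/-- The matrix of the bilinear pairings `∫ f i * g j ∂μ`, whose determinant is the value of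
Andréief's integral `∫ det (f i (x j)) * det (g i (x j))` up to a factorial. -/
noncomputable def pairingMatrix (μ : Measure E) (f g : ι → E → 𝕜) : Matrix ι ι 𝕜 :=
  of fun i j => ∫ y, f i y * g j y ∂μ

variable [DecidableEq ι] {μ : Measure E} {f g : ι → E → 𝕜}

theorem integrable_update_mul {φ : E → 𝕜}
    (hfg : ∀ i j, Integrable (fun y => f i y * g j y) μ)
    (hφ : ∀ i j, Integrable (fun y => φ y * (f i y * g j y)) μ) (r i j : ι) :
    Integrable (fun y => Function.update f r (φ * f r) i y * g j y) μ := by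
  by_cases hi : i = r
  · subst hi
    simpa [mul_assoc] using hφ i j
  · simpa [hi] using hfg i j

theorem pairingMatrix_update (φ : E → 𝕜) (r : ι) :
    pairingMatrix μ (Function.update f r (φ * f r)) g =
      (pairingMatrix μ f g).updateRow r fun j => ∫ y, φ y * (f r y * g j y) ∂μ := by
  ext i j
  by_cases hi : i = r
  · subst hi
    simp [pairingMatrix, mul_assoc]
  · simp [pairingMatrix, hi]

end Pairing

section Andreief

variable {ι 𝕜 : Type*} [Fintype ι] [DecidableEq ι] [RCLike 𝕜]

section IndependentRows

variable {E : ι → Type*} [∀ i, MeasurableSpace (E i)] {μ : ∀ i, Measure (E i)}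
  [∀ i, SigmaFinite (μ i)] {h : ∀ i, ι → E i → 𝕜}

theorem integrable_det_of_rows (hh : ∀ i j, Integrable (h i j) (μ i)) :
    Integrable (fun x : ∀ i, E i => (of fun i j => h i j (x i)).det) (Measure.pi μ) := by
  simp only [← det_transpose (of _), det_apply', transpose_apply, of_apply]
  exact integrable_finsetSum _ fun σ _ =>
    (Integrable.fintype_prod_dep fun i => hh i (σ i)).const_mul _

theorem integral_det_of_rows (hh : ∀ i j, Integrable (h i j) (μ i)) :
    ∫ x, (of fun i j => h i j (x i)).det ∂Measure.pi μ =
      (of fun i j => ∫ y, h i j y ∂μ i).det := by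
  simp only [← det_transpose (of _), det_apply', transpose_apply, of_apply]
  rw [integral_finsetSum _ fun σ _ =>
    (Integrable.fintype_prod_dep fun i => hh i (σ i)).const_mul _]
  refine Finset.sum_congr rfl fun σ _ => ?_
  rw [integral_const_mul, integral_fintype_prod_eq_prod]

end IndependentRows

variable {E : Type*} [MeasurableSpace E] {μ : Measure E} [SigmaFinite μ] {f g : ι → E → 𝕜}

theorem integrable_det_mul_det_alternantMatrix
    (hfg : ∀ i j, Integrable (fun y => f i y * g j y) μ) :
    Integrable (fun x => (alternantMatrix f x).det * (alternantMatrix g x).det)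
      (Measure.pi fun _ => μ) := by
  simp only [det_alternantMatrix_mul_det_alternantMatrix]
  exact integrable_finsetSum _ fun σ _ =>
    (integrable_det_of_rows fun i j => hfg (σ i) j).const_mul _

theorem integral_det_mul_det_alternantMatrix
    (hfg : ∀ i j, Integrable (fun y => f i y * g j y) μ) :
    ∫ x, (alternantMatrix f x).det * (alternantMatrix g x).det ∂Measure.pi (fun _ => μ) =
      (Fintype.card ι).factorial * (pairingMatrix μ f g).det := by
  have integral_term (σ : Perm ι) :
      ∫ x, (Perm.sign σ : 𝕜) * (of fun i j => f (σ i) (x i) * g j (x i)).det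
        ∂Measure.pi (fun _ => μ) = (pairingMatrix μ f g).det := by
    rw [integral_const_mul, integral_det_of_rows fun i j => hfg (σ i) j]
    change _ * ((pairingMatrix μ f g).submatrix σ id).det = _
    rw [det_permute, ← mul_assoc, ← Int.cast_mul, ← Units.val_mul, Int.units_mul_self,
      Units.val_one, Int.cast_one, one_mul]
  simp only [det_alternantMatrix_mul_det_alternantMatrix]
  rw [integral_finsetSum _ fun σ _ =>
    (integrable_det_of_rows fun i j => hfg (σ i) j).const_mul _]
  simp only [integral_term, Finset.sum_const, Finset.card_univ, Fintype.card_perm, nsmul_eq_mul]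

theorem integrable_sum_mul_det_mul_det_alternantMatrix {φ : E → 𝕜}
    (hfg : ∀ i j, Integrable (fun y => f i y * g j y) μ)
    (hφ : ∀ i j, Integrable (fun y => φ y * (f i y * g j y)) μ) :
    Integrable (fun x => (∑ i, φ (x i)) *
      ((alternantMatrix f x).det * (alternantMatrix g x).det)) (Measure.pi fun _ => μ) := by
  simp only [sum_mul_det_mul_det_alternantMatrix]
  exact integrable_finsetSum _ fun r _ =>
    integrable_det_mul_det_alternantMatrix (integrable_update_mul hfg hφ r)

theorem integral_sum_mul_det_mul_det_alternantMatrix {φ : E → 𝕜}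
    (hfg : ∀ i j, Integrable (fun y => f i y * g j y) μ)
    (hφ : ∀ i j, Integrable (fun y => φ y * (f i y * g j y)) μ) :
    ∫ x, (∑ i, φ (x i)) * ((alternantMatrix f x).det * (alternantMatrix g x).det)
        ∂Measure.pi (fun _ => μ) =
      (Fintype.card ι).factorial * ∑ r, ((pairingMatrix μ f g).updateRow r
        fun j => ∫ y, φ y * (f r y * g j y) ∂μ).det := by
  simp only [sum_mul_det_mul_det_alternantMatrix]
  rw [integral_finsetSum _ fun r _ =>
    integrable_det_mul_det_alternantMatrix (integrable_update_mul hfg hφ r), Finset.mul_sum]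
  refine Finset.sum_congr rfl fun r _ => ?_
  rw [integral_det_mul_det_alternantMatrix (integrable_update_mul hfg hφ r), pairingMatrix_update]

end Andreief

section Lagrange

variable {ι F : Type*} [Fintype ι] [DecidableEq ι] [Field F] {v : ι → F}

theorem eval_eq_sum_eval_mul_eval_lagrangeBasis (hv : Function.Injective v) {P : F[X]}
    (hP : P.degree < Fintype.card ι) (y : F) :
    P.eval y = ∑ s, P.eval (v s) * (Lagrange.basis Finset.univ v s).eval y := by
  nth_rw 1 [Lagrange.eq_interpolate (f := P) (s := Finset.univ) hv.injOn (by simpa using hP)]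
  simp [Lagrange.interpolate_apply, eval_finsetSum]

theorem det_updateRow_mul_eval (hv : Function.Injective v) {ρ : ι → F} (hρ : ∀ i, ρ i ≠ 0)
    {P : ι → F[X]} (hP : ∀ j, (P j).degree < Fintype.card ι) (r : ι) (c y : F) :
    ((of fun i j => ρ i * (P j).eval (v i)).updateRow r fun j => c * (P j).eval y).det =
      c / ρ r * (Lagrange.basis Finset.univ v r).eval y *
        (of fun i j => ρ i * (P j).eval (v i)).det := by
  set A := of fun i j => ρ i * (P j).eval (v i) with hA
  have row_eq : (fun j => c * (P j).eval y) =
      ∑ s, (c / ρ s * (Lagrange.basis Finset.univ v s).eval y) • A s := by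
    ext j
    rw [eval_eq_sum_eval_mul_eval_lagrangeBasis hv (hP j), Finset.mul_sum, Finset.sum_apply]
    refine Finset.sum_congr rfl fun s _ => ?_
    rw [Pi.smul_apply, smul_eq_mul, hA, of_apply]
    field_simp [hρ s]
  rw [row_eq, det_updateRow_sum, smul_eq_mul]

variable {K : Type*} [Field K] [CharZero K]

theorem prod_univ_erase_fin {M : Type*} [CommMonoid M] {N : ℕ} (r : Fin N) (f : ℕ → M) :
    ∏ s ∈ Finset.univ.erase r, f s =
      (∏ s ∈ Finset.range r, f s) * ∏ s ∈ Finset.range r.rev, f (r + 1 + s) := by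
  have hN : (r : ℕ) + 1 + r.rev = N := by rw [Fin.val_rev]; omega
  calc ∏ s ∈ Finset.univ.erase r, f s
      = ∏ s : Fin N, if (s : ℕ) = r then 1 else f s := by
        simp [Finset.prod_ite, Fin.val_inj, Finset.filter_ne']
    _ = ∏ s ∈ Finset.range (r + 1 + r.rev), if s = r then 1 else f s := by
        rw [hN, Finset.prod_range]
    _ = _ := by
        rw [Finset.prod_range_add, Finset.prod_range_succ, if_pos rfl, mul_one]
        refine congrArg₂ _ (Finset.prod_congr rfl fun s hs => if_neg ?_)
          (Finset.prod_congr rfl fun s _ => if_neg (by omega))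
        exact (Finset.mem_range.1 hs).ne

theorem prod_range_add_sub_div_sub (r k : ℕ) :
    ∏ s ∈ Finset.range r, ((r : K) + k - s) / (r - s) =
      (ascPochhammer K k).eval ((r : K) + 1) / k.factorial := by
  have hnum : (r.factorial : K) * (ascPochhammer K k).eval ((r : K) + 1) = (r + k).factorial :=
    factorial_mul_ascPochhammer K r k
  have hden : (k.factorial : K) * (r + k).descFactorial r = (r + k).factorial := by
    have h := Nat.factorial_mul_descFactorial (Nat.le_add_right r k)
    rw [Nat.add_sub_cancel_left] at h
    exact_mod_cast h
  have factorial_ne_zero (n : ℕ) : (n.factorial : K) ≠ 0 := Nat.cast_ne_zero.2 n.factorial_ne_zero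
  rw [Finset.prod_div_distrib, ← descPochhammer_eval_eq_prod_range,
    ← descPochhammer_eval_eq_prod_range, ← Nat.cast_add, descPochhammer_eval_eq_descFactorial,
    descPochhammer_eval_eq_descFactorial, Nat.descFactorial_self,
    div_eq_div_iff (factorial_ne_zero r) (factorial_ne_zero k)]
  linear_combination hden - hnum

theorem prod_range_sub_div_neg_add_one (n i : ℕ) :
    ∏ s ∈ Finset.range i, ((n : K) - s) / -(s + 1) = (-1) ^ i * n.choose i := by
  calc ∏ s ∈ Finset.range i, ((n : K) - s) / -(s + 1)
      = ∏ s ∈ Finset.range i, -1 * (((n : K) - s) / (s + 1 : ℕ)) :=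
        Finset.prod_congr rfl fun s _ => by rw [div_neg, neg_one_mul, Nat.cast_succ]
    _ = (-1) ^ i * n.choose i := by
        rw [Finset.prod_mul_distrib, Finset.prod_const, Finset.card_range, Finset.prod_div_distrib,
          Nat.cast_choose_eq_descPochhammer_div, descPochhammer_eval_eq_prod_range,
          ← Finset.prod_range_add_one_eq_factorial, Nat.cast_prod]

theorem eval_lagrangeBasis_natCast_add {N : ℕ} (r : Fin N) {k : ℕ} (hk : 0 < k) :
    (Lagrange.basis Finset.univ (fun s : Fin N => (s : K)) r).eval ((r : K) + k) =
      (-1) ^ (r.rev : ℕ) * (k - 1).choose r.rev *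
        ((ascPochhammer K k).eval ((r : K) + 1) / k.factorial) := by
  have hfactor (s : ℕ) : ((r : K) + k - (r + 1 + s : ℕ)) / (r - (r + 1 + s : ℕ)) =
      ((k - 1 : ℕ) - s) / -(s + 1) := by
    rw [Nat.cast_pred hk]
    push_cast
    congr 1 <;> ring
  calc (Lagrange.basis Finset.univ (fun s : Fin N => (s : K)) r).eval ((r : K) + k)
      = ∏ s ∈ Finset.univ.erase r, ((r : K) + k - s) / (r - s) := by
        simp [Lagrange.basis, Lagrange.basisDivisor, eval_prod, div_eq_inv_mul]
    _ = (∏ s ∈ Finset.range r, ((r : K) + k - s) / (r - s)) *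
          ∏ s ∈ Finset.range r.rev, ((k - 1 : ℕ) - s : K) / -(s + 1) := by
        rw [prod_univ_erase_fin r fun s => ((r : K) + k - s) / (r - s)]
        simp only [hfactor]
    _ = _ := by
        rw [prod_range_add_sub_div_sub, prod_range_sub_div_neg_add_one, mul_comm]

theorem prod_Icc_int_add {R : Type*} [CommRing R] (x : R) (i k : ℕ) :
    ∏ j ∈ Finset.Icc (-(i : ℤ)) ((k : ℤ) - i - 1), (x + j) = (ascPochhammer R k).eval (x - i) := by
  induction k with
  | zero => simp
  | succ k ih =>
    have hIcc : Finset.Icc (-(i : ℤ)) (((k + 1 : ℕ) : ℤ) - i - 1) =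
        insert ((k : ℤ) - i) (Finset.Icc (-(i : ℤ)) ((k : ℤ) - i - 1)) := by
      ext j
      simp only [Finset.mem_Icc, Finset.mem_insert]
      omega
    rw [hIcc, Finset.prod_insert (by simp), ih, ascPochhammer_succ_eval]
    push_cast
    ring

end Lagrange

section Beta

variable {x y : ℝ}

theorem Gamma_add_nat (hx : 0 < x) (n : ℕ) :
    Real.Gamma (x + n) = (ascPochhammer ℝ n).eval x * Real.Gamma x := by
  induction n with
  | zero => simp
  | succ n ih =>
    rw [Nat.cast_succ, ← add_assoc, Real.Gamma_add_one (by positivity), ih,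
      ascPochhammer_succ_eval]
    ring

theorem beta_add_nat_left (hx : 0 < x) (hy : 0 < y) (n : ℕ) :
    beta (x + n) y =
      (ascPochhammer ℝ n).eval x / (ascPochhammer ℝ n).eval (x + y) * beta x y := by
  rw [beta, beta, Gamma_add_nat hx, add_right_comm, Gamma_add_nat (add_pos hx hy)]
  ring

theorem beta_add_nat_right (hx : 0 < x) (hy : 0 < y) (n : ℕ) :
    beta x (y + n) =
      (ascPochhammer ℝ n).eval y / (ascPochhammer ℝ n).eval (x + y) * beta x y := by
  rw [beta, beta, Gamma_add_nat hy, ← add_assoc, Gamma_add_nat (add_pos hx hy)]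
  ring

theorem ascPochhammer_eval_mul_eval_add {S : Type*} [CommSemiring S] (x : S) (m n : ℕ) :
    (ascPochhammer S m).eval x * (ascPochhammer S n).eval (x + m) =
      (ascPochhammer S (m + n)).eval x := by
  rw [← ascPochhammer_mul]
  simp

theorem beta_add_nat_left_eq_mul_beta_add_nat_right (hx : 0 < x) (hy : 0 < y) {m n : ℕ}
    (hmn : m ≤ n) :
    beta (x + m) y = beta x (y + n) * ((ascPochhammer ℝ m).eval x *
      (ascPochhammer ℝ (n - m)).eval (x + y + m) / (ascPochhammer ℝ n).eval y) := by
  have hm : (ascPochhammer ℝ m).eval (x + y) ≠ 0 := (ascPochhammer_pos m _ (by positivity)).ne'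
  have hn : (ascPochhammer ℝ n).eval (x + y) ≠ 0 := (ascPochhammer_pos n _ (by positivity)).ne'
  have hny : (ascPochhammer ℝ n).eval y ≠ 0 := (ascPochhammer_pos n _ hy).ne'
  have hsplit := ascPochhammer_eval_mul_eval_add (x + y) m (n - m)
  rw [Nat.add_sub_cancel' hmn] at hsplit
  rw [beta_add_nat_left hx hy, beta_add_nat_right hx hy]
  field_simp
  rw [← hsplit]
  ring

end Beta

section Moments

variable {a b : ℝ}

/-- The one-variable Jacobi weight, which is the density of the beta integral. -/
noncomputable def betaKernel (a b y : ℝ) : ℝ :=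
  y ^ (a - 1) * (1 - y) ^ (b - 1)

theorem ofReal_betaKernel {y : ℝ} (hy : y ∈ Set.Ioc 0 1) :
    (betaKernel a b y : ℂ) = (y : ℂ) ^ ((a : ℂ) - 1) * (1 - (y : ℂ)) ^ ((b : ℂ) - 1) := by
  rw [betaKernel, Complex.ofReal_mul, Complex.ofReal_cpow hy.1.le,
    Complex.ofReal_cpow (sub_nonneg.2 hy.2)]
  push_cast
  rfl

theorem integrableOn_betaKernel (ha : 0 < a) (hb : 0 < b) :
    IntegrableOn (betaKernel a b) (Set.Icc 0 1) := by
  have hconv := Complex.betaIntegral_convergent (u := a) (v := b) (by simpa) (by simpa)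
  rw [intervalIntegrable_iff_integrableOn_Ioc_of_le zero_le_one] at hconv
  rw [integrableOn_Icc_iff_integrableOn_Ioc]
  exact IntegrableOn.congr_fun hconv.re (fun y hy => by simp [← ofReal_betaKernel hy])
    measurableSet_Ioc

theorem integral_betaKernel (ha : 0 < a) (hb : 0 < b) :
    ∫ y in Set.Icc 0 1, betaKernel a b y = beta a b := by
  rw [beta_eq_betaIntegralReal a b ha hb, Complex.betaIntegral,
    intervalIntegral.integral_of_le zero_le_one, integral_Icc_eq_integral_Ioc,
    ← setIntegral_congr_fun measurableSet_Ioc fun y hy => ofReal_betaKernel hy,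
    integral_complex_ofReal, Complex.ofReal_re]

theorem pow_mul_betaKernel (n : ℕ) {y : ℝ} (hy : 0 < y) :
    y ^ n * betaKernel a b y = betaKernel (a + n) b y := by
  rw [betaKernel, betaKernel, ← mul_assoc, ← Real.rpow_natCast, ← Real.rpow_add hy]
  congr 2
  ring

theorem integrableOn_pow_mul_betaKernel (ha : 0 < a) (hb : 0 < b) (n : ℕ) :
    IntegrableOn (fun y => y ^ n * betaKernel a b y) (Set.Icc 0 1) := by
  have hn := integrableOn_betaKernel (a := a + n) (by positivity) hb
  rw [integrableOn_Icc_iff_integrableOn_Ioc] at hn ⊢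
  exact hn.congr_fun (fun y hy => (pow_mul_betaKernel n hy.1).symm) measurableSet_Ioc

theorem integral_pow_mul_betaKernel (ha : 0 < a) (hb : 0 < b) (n : ℕ) :
    ∫ y in Set.Icc 0 1, y ^ n * betaKernel a b y = beta (a + n) b := by
  rw [← integral_betaKernel (by positivity) hb, integral_Icc_eq_integral_Ioc,
    integral_Icc_eq_integral_Ioc]
  exact setIntegral_congr_fun measurableSet_Ioc fun y hy => pow_mul_betaKernel n hy.1

end Moments

section Ensemble

theorem volume_restrict_Icc_eq_pi {ι : Type*} [Fintype ι] (u v : ι → ℝ) :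
    (volume : Measure (ι → ℝ)).restrict (Set.Icc u v) =
      Measure.pi fun i => volume.restrict (Set.Icc (u i) (v i)) := by
  rw [← Set.pi_univ_Icc, volume_pi, Measure.restrict_pi_pi]

theorem jacobiWeight_eq_det_mul_det (N : ℕ) (a b : ℝ) (x : Fin N → ℝ) :
    jacobiWeight N a b x =
      (alternantMatrix (fun (i : Fin N) y => y ^ (i : ℕ)) x).det *
        (alternantMatrix (fun (i : Fin N) y => y ^ (i : ℕ) * betaKernel a b y) x).det := by
  have det_left : (alternantMatrix (fun (i : Fin N) y => y ^ (i : ℕ)) x).det =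
      (vandermonde x).det := by
    rw [← det_transpose]
    rfl
  have det_right : (alternantMatrix (fun (i : Fin N) y => y ^ (i : ℕ) * betaKernel a b y) x).det =
      (∏ i, betaKernel a b (x i)) * (vandermonde x).det := by
    rw [← det_left, ← det_mul_row]
    simp only [alternantMatrix, of_apply, mul_comm]
  have prod_sq : ∏ i : Fin N, ∏ j ∈ Finset.Ioi i, (x i - x j) ^ 2 = (vandermonde x).det ^ 2 := by
    simp only [det_vandermonde, ← Finset.prod_pow, sub_sq_comm]
  rw [det_left, det_right, jacobiWeight, prod_sq]
  simp only [betaKernel]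
  ring

variable {a b : ℝ} {N : ℕ}

theorem integrableOn_pow_mul_pow_mul_betaKernel (ha : 0 < a) (hb : 0 < b) (i j : ℕ) :
    IntegrableOn (fun y => y ^ i * (y ^ j * betaKernel a b y)) (Set.Icc 0 1) := by
  simpa only [← mul_assoc, ← pow_add] using integrableOn_pow_mul_betaKernel ha hb (i + j)

theorem integrableOn_pow_mul_pow_mul_pow_mul_betaKernel (ha : 0 < a) (hb : 0 < b) (k i j : ℕ) :
    IntegrableOn (fun y => y ^ k * (y ^ i * (y ^ j * betaKernel a b y))) (Set.Icc 0 1) := by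
  simpa only [← mul_assoc, ← pow_add] using integrableOn_pow_mul_betaKernel ha hb (k + (i + j))

/-- The Hankel matrix of the moments `∫ y ^ (i + j) * betaKernel a b y` over `[0, 1]`, written
through the beta function; rows and columns are indexed from `0`. -/
noncomputable def betaMomentMatrix (N : ℕ) (a b : ℝ) : Matrix (Fin N) (Fin N) ℝ :=
  of fun i j => beta (a + i + j) b

theorem pairingMatrix_pow_betaKernel (ha : 0 < a) (hb : 0 < b) :
    pairingMatrix (volume.restrict (Set.Icc 0 1)) (fun (i : Fin N) y => y ^ (i : ℕ))
      (fun j y => y ^ (j : ℕ) * betaKernel a b y) = betaMomentMatrix N a b := by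
  ext i j
  simp only [pairingMatrix, betaMomentMatrix, of_apply, ← mul_assoc, ← pow_add]
  rw [integral_pow_mul_betaKernel ha hb, Nat.cast_add, add_assoc]

theorem integrableOn_jacobiWeight (ha : 0 < a) (hb : 0 < b) :
    IntegrableOn (jacobiWeight N a b) (Set.Icc 0 1) := by
  rw [IntegrableOn, volume_restrict_Icc_eq_pi, funext (jacobiWeight_eq_det_mul_det N a b)]
  exact integrable_det_mul_det_alternantMatrix fun i j : Fin N =>
    integrableOn_pow_mul_pow_mul_betaKernel ha hb i j

theorem jacobiBracket_one (ha : 0 < a) (hb : 0 < b) :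
    jacobiBracket N a b (fun _ => 1) = (betaMomentMatrix N a b).det := by
  have integral_eq := integral_det_mul_det_alternantMatrix
    (f := fun (i : Fin N) y => y ^ (i : ℕ))
    (g := fun (j : Fin N) y => y ^ (j : ℕ) * betaKernel a b y)
    fun i j => integrableOn_pow_mul_pow_mul_betaKernel ha hb i j
  rw [Fintype.card_fin, pairingMatrix_pow_betaKernel ha hb] at integral_eq
  simp only [jacobiBracket, one_mul, jacobiWeight_eq_det_mul_det, volume_restrict_Icc_eq_pi,
    Pi.zero_apply, Pi.one_apply, integral_eq]
  field_simp

theorem integrableOn_powerSum_mul_jacobiWeight (ha : 0 < a) (hb : 0 < b) (k : ℕ) :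
    IntegrableOn (fun x => powerSum N k x * jacobiWeight N a b x) (Set.Icc 0 1) := by
  simp only [IntegrableOn, volume_restrict_Icc_eq_pi, jacobiWeight_eq_det_mul_det, powerSum]
  exact integrable_sum_mul_det_mul_det_alternantMatrix (φ := fun y => y ^ k)
    (fun i j : Fin N => integrableOn_pow_mul_pow_mul_betaKernel ha hb i j)
    fun i j => integrableOn_pow_mul_pow_mul_pow_mul_betaKernel ha hb k i j

theorem jacobiBracket_powerSum (ha : 0 < a) (hb : 0 < b) (k : ℕ) :
    jacobiBracket N a b (powerSum N k) =
      ∑ r, ((betaMomentMatrix N a b).updateRow r fun j => beta (a + (r + k) + j) b).det := by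
  have moment (i j : ℕ) : ∫ y in Set.Icc 0 1, y ^ k * (y ^ i * (y ^ j * betaKernel a b y)) =
      beta (a + (i + k) + j) b := by
    simp only [← mul_assoc, ← pow_add]
    rw [integral_pow_mul_betaKernel ha hb]
    push_cast
    congr 1
    ring
  have integral_eq := integral_sum_mul_det_mul_det_alternantMatrix
    (f := fun (i : Fin N) y => y ^ (i : ℕ))
    (g := fun (j : Fin N) y => y ^ (j : ℕ) * betaKernel a b y)
    (φ := fun y => y ^ k) (fun i j => integrableOn_pow_mul_pow_mul_betaKernel ha hb i j)
    fun i j => integrableOn_pow_mul_pow_mul_pow_mul_betaKernel ha hb k i j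
  simp only [Fintype.card_fin, pairingMatrix_pow_betaKernel ha hb, moment] at integral_eq
  simp only [jacobiBracket, powerSum, jacobiWeight_eq_det_mul_det, volume_restrict_Icc_eq_pi,
    Pi.zero_apply, Pi.one_apply, integral_eq]
  field_simp

theorem jacobiWeight_nonneg {x : Fin N → ℝ} (hx : x ∈ Set.Icc 0 1) : 0 ≤ jacobiWeight N a b x :=
  mul_nonneg (Finset.prod_nonneg fun _ _ => Finset.prod_nonneg fun _ _ => sq_nonneg _)
    (Finset.prod_nonneg fun i _ => mul_nonneg (Real.rpow_nonneg (hx.1 i) _)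
      (Real.rpow_nonneg (sub_nonneg.2 (hx.2 i)) _))

theorem jacobiWeight_ne_zero {x : Fin N → ℝ} (hx : ∀ i, x i ∈ Set.Ioo 0 1)
    (hinj : Function.Injective x) : jacobiWeight N a b x ≠ 0 :=
  mul_ne_zero
    (Finset.prod_ne_zero_iff.2 fun _ _ => Finset.prod_ne_zero_iff.2 fun _ hj =>
      pow_ne_zero 2 (sub_ne_zero.2 (hinj.ne (Finset.mem_Ioi.1 hj).ne)))
    (Finset.prod_ne_zero_iff.2 fun i _ => mul_ne_zero (Real.rpow_pos_of_pos (hx i).1 _).ne'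
      (Real.rpow_pos_of_pos (sub_pos.2 (hx i).2) _).ne')

theorem continuousAt_jacobiWeight {x : Fin N → ℝ} (hx : ∀ i, x i ∈ Set.Ioo 0 1) :
    ContinuousAt (jacobiWeight N a b) x := by
  have continuousAt_factor (i : Fin N) :
      ContinuousAt (fun x : Fin N → ℝ => x i ^ (a - 1) * (1 - x i) ^ (b - 1)) x :=
    ((continuousAt_apply i x).rpow_const (.inl (hx i).1.ne')).mul
      ((continuousAt_const.sub (continuousAt_apply i x)).rpow_const
        (.inl (sub_pos.2 (hx i).2).ne'))
  exact (Continuous.continuousAt (by fun_prop)).mul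
    (tendsto_finsetProd _ fun i _ => continuousAt_factor i)

theorem exists_injective_mem_Ioo (N : ℕ) :
    ∃ x : Fin N → ℝ, (∀ i, x i ∈ Set.Ioo 0 1) ∧ Function.Injective x := by
  let e := (Set.Ioo_infinite (zero_lt_one (α := ℝ))).natEmbedding
  exact ⟨fun i => e i, fun i => (e i).2,
    Subtype.val_injective.comp (e.injective.comp Fin.val_injective)⟩

theorem jacobiBracket_one_pos (ha : 0 < a) (hb : 0 < b) :
    0 < jacobiBracket N a b (fun _ => 1) := by
  obtain ⟨x, hx, hinj⟩ := exists_injective_mem_Ioo N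
  have support_mem : Function.support (jacobiWeight N a b) ∈ nhds x :=
    (continuousAt_jacobiWeight hx).eventually_ne (jacobiWeight_ne_zero hx hinj)
  have cube_mem : Set.Icc 0 1 ∈ nhds x := by
    rw [← Set.pi_univ_Icc]
    exact set_pi_mem_nhds Set.finite_univ fun i _ => Icc_mem_nhds (hx i).1 (hx i).2
  simp only [jacobiBracket, one_mul]
  refine mul_pos (by positivity) ?_
  rw [setIntegral_pos_iff_support_of_nonneg_ae
    (ae_restrict_of_forall_mem measurableSet_Icc fun x hx => jacobiWeight_nonneg hx)
    (integrableOn_jacobiWeight ha hb)]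
  exact Measure.measure_pos_of_mem_nhds volume (Filter.inter_mem support_mem cube_mem)

theorem exists_beta_add_eq_mul_eval (hb : 0 < b) {m n : ℕ} (hmn : m ≤ n) :
    ∃ P : ℝ[X], P.natDegree ≤ n ∧ ∀ y, 0 < a + y →
      beta (a + y + m) b = beta (a + y) (b + n) * P.eval y := by
  refine ⟨(ascPochhammer ℝ m).comp (X + C a) * (ascPochhammer ℝ (n - m)).comp (X + C (a + b + m)) *
    C ((ascPochhammer ℝ n).eval b)⁻¹, ?_, fun y hy => ?_⟩
  · refine (natDegree_mul_C_le _ _).trans (natDegree_mul_le.trans ?_)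
    simp only [natDegree_comp, natDegree_X_add_C, ascPochhammer_natDegree]
    omega
  · rw [beta_add_nat_left_eq_mul_beta_add_nat_right hy hb hmn]
    simp only [eval_mul, eval_comp, eval_add, eval_X, eval_C, div_eq_mul_inv]
    ring_nf

theorem det_betaMomentMatrix_updateRow (ha : 0 < a) (hb : 0 < b) (r : Fin N) (k : ℕ) :
    ((betaMomentMatrix N a b).updateRow r fun j => beta (a + (r + k) + j) b).det =
      (ascPochhammer ℝ k).eval (a + r) / (ascPochhammer ℝ k).eval (a + b + N + r - 1) *
        (Lagrange.basis Finset.univ (fun s : Fin N => (s : ℝ)) r).eval ((r : ℝ) + k) *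
        (betaMomentMatrix N a b).det := by
  choose P natDegree_le eval_eq using fun j : Fin N =>
    exists_beta_add_eq_mul_eval (a := a) hb (Nat.le_sub_one_of_lt j.2)
  have hP (j : Fin N) : (P j).degree < Fintype.card (Fin N) := by
    rw [Fintype.card_fin]
    exact degree_le_natDegree.trans_lt
      (Nat.cast_lt.2 ((natDegree_le j).trans_lt (Nat.sub_one_lt r.pos.ne')))
  have hρ (y : ℝ) (hy : 0 ≤ y) : 0 < beta (a + y) (b + (N - 1 : ℕ)) :=
    beta_pos (by positivity) (by positivity)
  have matrix_eq : betaMomentMatrix N a b =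
      of fun i j : Fin N => beta (a + i) (b + (N - 1 : ℕ)) * (P j).eval (i : ℝ) := by
    ext i j
    exact eval_eq j i (by positivity)
  have row_eq : (fun j : Fin N => beta (a + (r + k) + j) b) =
      fun j => beta (a + (r + k)) (b + (N - 1 : ℕ)) * (P j).eval ((r : ℝ) + k) :=
    funext fun j => eval_eq j (r + k) (by positivity)
  have ratio_eq : beta (a + (r + k)) (b + (N - 1 : ℕ)) / beta (a + r) (b + (N - 1 : ℕ)) =
      (ascPochhammer ℝ k).eval (a + r) / (ascPochhammer ℝ k).eval (a + b + N + r - 1) := by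
    rw [← add_assoc, beta_add_nat_left (by positivity) (by positivity),
      mul_div_cancel_right₀ _ (hρ r (by positivity)).ne', Nat.cast_pred r.pos]
    congr 2
    ring
  rw [row_eq, matrix_eq, det_updateRow_mul_eval
    (fun s t h => Fin.ext (Nat.cast_injective h)) (fun i => (hρ i (by positivity)).ne') hP,
    ratio_eq]

theorem jacobiMoment_eq_sum_fin (ha : 0 < a) (hb : 0 < b) (k : ℕ) :
    jacobiMoment N a b k = ∑ r : Fin N,
      (ascPochhammer ℝ k).eval (a + r) / (ascPochhammer ℝ k).eval (a + b + N + r - 1) *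
        (Lagrange.basis Finset.univ (fun s : Fin N => (s : ℝ)) r).eval ((r : ℝ) + k) := by
  rw [jacobiMoment, div_eq_iff (jacobiBracket_one_pos ha hb).ne', jacobiBracket_powerSum ha hb,
    jacobiBracket_one ha hb, Finset.sum_mul]
  exact Finset.sum_congr rfl fun r _ => det_betaMomentMatrix_updateRow ha hb r k

theorem jacobiMoment_eq_sum_range (ha : 0 < a) (hb : 0 < b) {k : ℕ} (hk : 0 < k) :
    jacobiMoment N a b k = 1 / (k.factorial : ℝ) *
      ∑ i ∈ Finset.range N, (-1) ^ i * (k - 1).choose i *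
        ((ascPochhammer ℝ k).eval ((N : ℝ) - i) * (ascPochhammer ℝ k).eval (a + N - 1 - i) /
          (ascPochhammer ℝ k).eval (a + b + 2 * N - 2 - i)) := by
  rw [jacobiMoment_eq_sum_fin ha hb, Finset.sum_range, Finset.mul_sum,
    ← Equiv.sum_comp Fin.revPerm]
  refine Finset.sum_congr rfl fun i _ => ?_
  have cast_rev : ((i.rev : ℕ) : ℝ) = N - 1 - i := by
    rw [Fin.val_rev, Nat.cast_sub i.2]
    push_cast
    ring
  rw [Fin.revPerm_apply, eval_lagrangeBasis_natCast_add _ hk, Fin.rev_rev, cast_rev]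
  ring_nf

end Ensemble

theorem prod_Icc_eq_ascPochhammer (N i k : ℕ) (a b : ℝ) :
    ∏ j ∈ Finset.Icc (-(i : ℤ)) ((k : ℤ) - (i : ℤ) - 1),
        ((N : ℝ) + (j : ℝ)) * (a + (N : ℝ) + (j : ℝ) - 1) / (a + b + 2 * (N : ℝ) + (j : ℝ) - 2) =
      (ascPochhammer ℝ k).eval ((N : ℝ) - i) * (ascPochhammer ℝ k).eval (a + N - 1 - i) /
        (ascPochhammer ℝ k).eval (a + b + 2 * N - 2 - i) := by
  simp only [← prod_Icc_int_add, ← Finset.prod_mul_distrib, ← Finset.prod_div_distrib]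
  refine Finset.prod_congr rfl fun j _ => ?_
  congr 2 <;> ring

/-- The first three conjuncts say that `⟨1⟩_{a,b}` and `⟨p_k⟩_{a,b}` are genuine (convergent)
integrals and that the quotient defining `I_k` has a nonzero denominator. For `i ≥ N` the product
contains the factor `j = -N`, which is `0`; such summands vanish. For `i < N` every denominator is
positive. -/
theorem mainTheorem4 (N : ℕ) (a b : ℝ) (ha : 0 < a) (hb : 0 < b) (k : ℕ) (hk : 0 < k) :
    IntegrableOn (jacobiWeight N a b) (Set.Icc (0 : Fin N → ℝ) 1) ∧
    IntegrableOn (fun x => powerSum N k x * jacobiWeight N a b x)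
      (Set.Icc (0 : Fin N → ℝ) 1) ∧
    0 < jacobiBracket N a b (fun _ => 1) ∧
    jacobiMoment N a b k =
      1 / (k.factorial : ℝ) *
        ∑ i ∈ Finset.range k, (-1 : ℝ) ^ i * ((k - 1).choose i : ℝ) *
          ∏ j ∈ Finset.Icc (-(i : ℤ)) ((k : ℤ) - (i : ℤ) - 1),
            ((N : ℝ) + (j : ℝ)) * (a + (N : ℝ) + (j : ℝ) - 1) /
              (a + b + 2 * (N : ℝ) + (j : ℝ) - 2) := by
  refine ⟨integrableOn_jacobiWeight ha hb, integrableOn_powerSum_mul_jacobiWeight ha hb k,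
    jacobiBracket_one_pos ha hb, ?_⟩
  simp only [jacobiMoment_eq_sum_range ha hb hk, prod_Icc_eq_ascPochhammer]
  congr 1
  refine Finset.sum_congr_of_eq_on_inter (fun i _ hki => ?_) (fun i hik hNi => ?_)
    fun _ _ _ => rfl
  · have choose_eq_zero : (k - 1).choose i = 0 := Nat.choose_eq_zero_of_lt (by grind)
    simp [choose_eq_zero]
  · have eval_eq_zero : (ascPochhammer ℝ k).eval ((N : ℝ) - i) = 0 := by
      simp only [Finset.mem_range, not_lt] at hik hNi
      rw [← neg_sub, ← Nat.cast_sub hNi]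
      exact ascPochhammer_eval_neg_coe_nat_of_lt (by omega)
    simp [eval_eq_zero]
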